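/- Let $\Omega$ be a finite sample space, $n\ge 0$, and let $X_1,\dots,X_n$ be random variables on $\Omega$ with finite value spaces. For $A\subseteq[n]=\{1,\dots,n\}$ let $X_A$ denote the joint variable of the $X_i$, $i\in A$. For a probability mass function $P$ on $\Omega$, the sequence $X_1,\dots,X_n$ is a $P$-Markov chain if for all $2\le i\le n$ the variable $X_i$ is $P$-independent of $X_{\{1,\dots,i-2\}}$ given $X_{i-1}$. Let $D$ be the set of all pairs $(P\|Q)$ of probability mass functions on $\Omega$ such that - $P\ll Q$, i.e. $Q(\omega)=0$ implies $P(\omega)=0$; - $X_1,\dots,X_n$ is a $P$-Markov chain and a $Q$-Markov chain; - $P(x_i\mid x_{i-1})=Q(x_i\mid x_{i-1})$ for all $2\le i\le n$ and all $(x_{i-1},x_i)$ with $P(x_{i-1})\ne 0$. Let $G$ be the abelian group of measurable functions $D\to\mathbb R$. For $A\subseteq[n]$ and $f\in G$ define elements of $G$ by $$[X_A.f](P\|Q)=\sum_{x:\,P(X_A=x)\neq 0}P(X_A=x)\, f\big(P|_{X_A=x}\,\|\,Q|_{X_A=x}\big),\qquad [\mathrm{KL}_1(X_A)](P\|Q)=\sum_{x:\,P(X_A=x)\ne0}P(X_A=x)\log\frac{P(X_A=x)}{Q(X_A=x)},$$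 (conditioning on a value of $X_A$ of positive $P$-probability does not lead out of $D$), and, for $q\ge 2$ and $L_1,\dots,L_q\subseteq[n]$, $$\mathrm{KL}_q(X_{L_1};\dots;X_{L_q})=\mathrm{KL}_{q-1}(X_{L_1};\dots;X_{L_{q-1}})-X_{L_q}.\mathrm{KL}_{q-1}(X_{L_1};\dots;X_{L_{q-1}}).$$ Let $\widetilde X=\{p_I : \emptyset\ne I\subseteq[n]\}$ be a set of $2^n-1$ distinct atoms, and for $A\subseteq[n]$ let $\widetilde X_A=\{p_I : I\cap A\ne\emptyset\}$. A $G$-valued measure on $\widetilde X$ is a map $\mu:2^{\widetilde X}\to G$ with $\mu(A\cup B)=\mu(A)+\mu(B)$ for all disjoint $A,B$. **Theorem (structure of the restricted KL diagram).** There is exactly one $G$-valued measure $\mu$ on $\widetilde X$ such that $$X_J.\mathrm{KL}_q(X_{L_1};\dots;X_{L_q})=\mu\Big(\bigcap_{k=1}^q\widetilde X_{L_k}\setminus\widetilde X_J\Big)\qquad\text{for all } q\ge1,\ J,L_1,\dots,L_q\subseteq[n].$$ This measure satisfies: 1. $\mu(\{p_I\})=0$ for every nonempty $I\subseteq[n]$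 that is not a set of consecutive integers; 2. $\mu(\{p_{\{i,i+1,\dots,k\}}\})=0$ for all $2\le i\le k\le n$. In other words, all atoms other than those of the form $p_{\{1,\dots,k\}}$ vanish. -/

import Mathlib

open MeasureTheory Finset

universe u v

namespace KLDiagram

noncomputable section

/-! ### Finite probability spaces and discrete random variables -/

/-- Probability mass functions on a finite sample space, with the measurable structure
inherited from the product space of all real functions on it. -/
abbrev Simplex (Ω : Type u) [Fintype Ω] : Type u := stdSimplex ℝ Ω

/-- A finite discrete random variable on a sample space. -/
structure DiscreteRV (Ω : Type u) where
  /-- the value space -/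
  Val : Type v
  /-- the value space is finite -/
  fin : Fintype Val
  /-- the underlying function -/
  toFun : Ω → Val

attribute [instance] DiscreteRV.fin

/-- The joint variable of two random variables. -/
def DiscreteRV.joint {Ω : Type u} (X Y : DiscreteRV.{u, v} Ω) : DiscreteRV.{u, v} Ω where
  Val := X.Val × Y.Val
  fin := inferInstance
  toFun := fun ω => (X.toFun ω, Y.toFun ω)

/-- The joint variable `X_A` of the variables `X i` with `i ∈ A`.
For `A = ∅` its value space has exactly one element. -/
def jointOn {Ω : Type u} {n : ℕ} (X : Fin n → DiscreteRV.{u, v} Ω) (A : Finset (Fin n)) :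
    DiscreteRV.{u, v} Ω where
  Val := ∀ i : A, (X i).Val
  fin := inferInstance
  toFun := fun ω i => (X i).toFun ω

variable {Ω : Type u} [Fintype Ω]

open Classical in
/-- The law of a random variable: `law P X x = P(X = x)`. -/
def law (P : Simplex Ω) (X : DiscreteRV.{u, v} Ω) (x : X.Val) : ℝ :=
  ∑ ω, if X.toFun ω = x then P.1 ω else 0

/-- The conditional probability `P(x | z) = P(x, z) / P(z)`, which is `0` if `P(z) = 0`. -/
def condLaw (P : Simplex Ω) (X Z : DiscreteRV.{u, v} Ω) (x : X.Val) (z : Z.Val) : ℝ :=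
  law P (X.joint Z) (x, z) / law P Z z

/-- `X` and `Y` are `P`-independent given `Z`: `P(x, y, z) = P(x | z) * P(y, z)`. -/
def CondIndep (P : Simplex Ω) (X Y Z : DiscreteRV.{u, v} Ω) : Prop :=
  ∀ (x : X.Val) (y : Y.Val) (z : Z.Val),
    law P (X.joint (Y.joint Z)) (x, y, z) = condLaw P X Z x z * law P (Y.joint Z) (y, z)

/-- `X 0, …, X (n-1)` form a `P`-Markov chain: each `X j` is `P`-independent of the joint of
all variables before `X i`, given `X i`, where `i` is the predecessor of `j`. -/
def IsMarkovChain {n : ℕ} (X : Fin n → DiscreteRV.{u, v} Ω) (P : Simplex Ω) : Prop :=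
  ∀ i j : Fin n, (j : ℕ) = i + 1 → CondIndep P (X j) (jointOn X (Finset.Iio i)) (X i)

/-! ### Pairs of distributions, and conditioning -/

/-- `P ≪ Q`. -/
def AbsCont (P Q : Simplex Ω) : Prop := ∀ ω, Q.1 ω = 0 → P.1 ω = 0

variable (Ω) in
/-- The space of pairs `(P ‖ Q)` with `P ≪ Q`. -/
abbrev ACPair : Type u := {p : Simplex Ω × Simplex Ω // AbsCont p.1 p.2}

theorem law_nonneg (P : Simplex Ω) (X : DiscreteRV.{u, v} Ω) (x : X.Val) : 0 ≤ law P X x := by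
  classical
  refine Finset.sum_nonneg fun ω _ => ?_
  split_ifs
  · exact P.2.1 ω
  · exact le_rfl

open Classical in
/-- The conditional distribution `P|_{X = x}`, with mass function
`ω ↦ P({ω} ∩ {X = x}) / P(X = x)`, for `P(X = x) ≠ 0`. -/
def cond (P : Simplex Ω) (X : DiscreteRV.{u, v} Ω) (x : X.Val) (h : law P X x ≠ 0) :
    Simplex Ω :=
  ⟨fun ω => (if X.toFun ω = x then P.1 ω else 0) / law P X x, by
    refine ⟨fun ω => div_nonneg ?_ (law_nonneg P X x), ?_⟩
    · split_ifs
      · exact P.2.1 ω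
      · exact le_rfl
    · rw [← Finset.sum_div]
      exact div_self h⟩

theorem law_ne_zero_of_absCont {P Q : Simplex Ω} (hPQ : AbsCont P Q) (X : DiscreteRV.{u, v} Ω)
    (x : X.Val) (h : law P X x ≠ 0) : law Q X x ≠ 0 := by
  classical
  intro h0
  apply h
  have h1 := (Finset.sum_eq_zero_iff_of_nonneg (fun ω _ => by
    split_ifs
    · exact Q.2.1 ω
    · exact le_rfl)).1 h0
  refine Finset.sum_eq_zero fun ω hω => ?_
  have h2 := h1 ω hω
  split_ifs with hx
  · rw [if_pos hx] at h2
    exact hPQ ω h2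
  · rfl

theorem absCont_cond {P Q : Simplex Ω} (hPQ : AbsCont P Q) (X : DiscreteRV.{u, v} Ω)
    (x : X.Val) (hP : law P X x ≠ 0) (hQ : law Q X x ≠ 0) :
    AbsCont (cond P X x hP) (cond Q X x hQ) := by
  classical
  intro ω h
  change (if X.toFun ω = x then Q.1 ω else 0) / law Q X x = 0 at h
  change (if X.toFun ω = x then P.1 ω else 0) / law P X x = 0
  rw [div_eq_zero_iff, or_iff_left hQ] at h
  rw [div_eq_zero_iff]
  left
  split_ifs with hx
  · rw [if_pos hx] at h
    exact hPQ ω h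
  · rfl

open Classical in
/-- Conditioning of a pair: `(P ‖ Q) ↦ (P|_{X = x} ‖ Q|_{X = x})` if `P(X = x) ≠ 0`.
If `P(X = x) = 0` the pair is left unchanged; this value is only ever used with the
coefficient `P(X = x) = 0`. -/
def condPair (X : DiscreteRV.{u, v} Ω) (x : X.Val) (p : ACPair Ω) : ACPair Ω :=
  if h : law p.1.1 X x ≠ 0 then
    ⟨(cond p.1.1 X x h, cond p.1.2 X x (law_ne_zero_of_absCont p.2 X x h)),
      absCont_cond p.2 X x h (law_ne_zero_of_absCont p.2 X x h)⟩
  else p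

/-! ### Measurable functions, the conditioning action, Kullback-Leibler divergence -/

/-- The abelian group of measurable real functions on a measurable space. -/
abbrev Meas (D : Type u) [MeasurableSpace D] : AddSubgroup (D → ℝ) where
  carrier := {f | Measurable f}
  add_mem' := fun hf hg => Measurable.add hf hg
  zero_mem' := measurable_const
  neg_mem' := fun hf => Measurable.neg hf

theorem measurable_law (X : DiscreteRV.{u, v} Ω) (x : X.Val) :
    Measurable fun P : Simplex Ω => law P X x := by
  classical
  refine Finset.measurable_sum _ fun ω _ => ?_
  by_cases h : X.toFun ω = x
  · simp only [h, if_true]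
    exact (measurable_pi_apply ω).comp measurable_subtype_coe
  · simp only [h, if_false]
    exact measurable_const

theorem measurable_mass_fst (ω : Ω) : Measurable fun p : ACPair Ω => p.1.1.1 ω :=
  (measurable_pi_apply ω).comp
    (measurable_subtype_coe.comp (measurable_fst.comp measurable_subtype_coe))

theorem measurable_mass_snd (ω : Ω) : Measurable fun p : ACPair Ω => p.1.2.1 ω :=
  (measurable_pi_apply ω).comp
    (measurable_subtype_coe.comp (measurable_snd.comp measurable_subtype_coe))

theorem measurable_law_fst (X : DiscreteRV.{u, v} Ω) (x : X.Val) :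
    Measurable fun p : ACPair Ω => law p.1.1 X x :=
  (measurable_law X x).comp (measurable_fst.comp measurable_subtype_coe)

theorem measurable_law_snd (X : DiscreteRV.{u, v} Ω) (x : X.Val) :
    Measurable fun p : ACPair Ω => law p.1.2 X x :=
  (measurable_law X x).comp (measurable_snd.comp measurable_subtype_coe)

theorem measurable_condPair (X : DiscreteRV.{u, v} Ω) (x : X.Val) :
    Measurable (condPair (Ω := Ω) X x) := by
  classical
  have hS : MeasurableSet {p : ACPair Ω | law p.1.1 X x ≠ 0} :=
    (measurable_law_fst X x (measurableSet_singleton 0)).compl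
  have h1 : ∀ ω, Measurable fun p : ACPair Ω => (condPair X x p).1.1.1 ω := by
    intro ω
    have he : (fun p : ACPair Ω => (condPair X x p).1.1.1 ω) = fun p : ACPair Ω =>
        if law p.1.1 X x ≠ 0 then (if X.toFun ω = x then p.1.1.1 ω else 0) / law p.1.1 X x
        else p.1.1.1 ω := by
      funext p
      unfold condPair
      split_ifs <;> simp_all [cond]
    rw [he]
    refine Measurable.ite hS (Measurable.div ?_ (measurable_law_fst X x)) (measurable_mass_fst ω)
    exact Measurable.ite (MeasurableSet.const _) (measurable_mass_fst ω) measurable_const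
  have h2 : ∀ ω, Measurable fun p : ACPair Ω => (condPair X x p).1.2.1 ω := by
    intro ω
    have he : (fun p : ACPair Ω => (condPair X x p).1.2.1 ω) = fun p : ACPair Ω =>
        if law p.1.1 X x ≠ 0 then (if X.toFun ω = x then p.1.2.1 ω else 0) / law p.1.2 X x
        else p.1.2.1 ω := by
      funext p
      unfold condPair
      split_ifs <;> simp_all [cond]
    rw [he]
    refine Measurable.ite hS (Measurable.div ?_ (measurable_law_snd X x)) (measurable_mass_snd ω)
    exact Measurable.ite (MeasurableSet.const _) (measurable_mass_snd ω) measurable_const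
  exact Measurable.subtype_mk (f := fun p : ACPair Ω => (condPair X x p).1)
    (Measurable.prodMk (Measurable.subtype_mk (measurable_pi_iff.2 h1))
      (Measurable.subtype_mk (measurable_pi_iff.2 h2)))

/-- The conditioning action on measurable functions:
`[X.f](P ‖ Q) = ∑ x, P(x) * f(P|_{X = x} ‖ Q|_{X = x})`. -/
def act (X : DiscreteRV.{u, v} Ω) (f : Meas (ACPair Ω)) : Meas (ACPair Ω) :=
  ⟨fun p => ∑ x, law p.1.1 X x * f.1 (condPair X x p),
    Finset.measurable_sum _ fun x _ =>
      (measurable_law_fst X x).mul (f.2.comp (measurable_condPair X x))⟩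

/-- The Kullback-Leibler divergence `[KL(X)](P ‖ Q) = ∑ x, P(x) * log (P(x) / Q(x))`.
A summand with `P(x) = 0` is `0`. -/
def kl (X : DiscreteRV.{u, v} Ω) : Meas (ACPair Ω) :=
  ⟨fun p => ∑ x, law p.1.1 X x * Real.log (law p.1.1 X x / law p.1.2 X x),
    Finset.measurable_sum _ fun x _ => (measurable_law_fst X x).mul
      (Real.measurable_log.comp ((measurable_law_fst X x).div (measurable_law_snd X x)))⟩

/-! ### Restriction to Markov chains with equal transition probabilities -/

variable {n : ℕ}

/-- The property of a pair `(P ‖ Q)` (with `P ≪ Q`) that the variables form a Markov chain for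
both distributions and that `P(x_j | x_i) = Q(x_j | x_i)` whenever `j` is the successor of `i`
and `P(x_i) ≠ 0`. -/
def EqualTransitions (X : Fin n → DiscreteRV.{u, v} Ω) (p : ACPair Ω) : Prop :=
  IsMarkovChain X p.1.1 ∧ IsMarkovChain X p.1.2 ∧
    ∀ i j : Fin n, (j : ℕ) = i + 1 → ∀ (x : (X i).Val) (y : (X j).Val),
      law p.1.1 (X i) x ≠ 0 →
        condLaw p.1.1 (X j) (X i) y x = condLaw p.1.2 (X j) (X i) y x

/-- The pairs `(P ‖ Q)`, `P ≪ Q`, of Markov chains with equal transition probabilities. -/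
abbrev RestrictedPair (X : Fin n → DiscreteRV.{u, v} Ω) : Type u :=
  {p : ACPair Ω // EqualTransitions X p}

theorem measurableSet_equalTransitions (X : Fin n → DiscreteRV.{u, v} Ω) :
    MeasurableSet {p : ACPair Ω | EqualTransitions X p} := by
  have hM1 : Measurable fun p : ACPair Ω => IsMarkovChain X p.1.1 := by
    refine .forall fun i => .forall fun j => .imp measurable_const ?_
    refine .forall fun x => .forall fun y => .forall fun z => ?_
    refine measurableSet_setOfPred.1 (measurableSet_eq_fun (measurable_law_fst _ _) ?_)
    exact ((measurable_law_fst _ _).div (measurable_law_fst _ _)).mul (measurable_law_fst _ _)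
  have hM2 : Measurable fun p : ACPair Ω => IsMarkovChain X p.1.2 := by
    refine .forall fun i => .forall fun j => .imp measurable_const ?_
    refine .forall fun x => .forall fun y => .forall fun z => ?_
    refine measurableSet_setOfPred.1 (measurableSet_eq_fun (measurable_law_snd _ _) ?_)
    exact ((measurable_law_snd _ _).div (measurable_law_snd _ _)).mul (measurable_law_snd _ _)
  refine measurableSet_setOfPred.2 (hM1.and (hM2.and ?_))
  refine .forall fun i => .forall fun j => .imp measurable_const ?_
  refine .forall fun x => .forall fun y => .imp ?_ ?_
  · exact measurableSet_setOfPred.1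
      ((measurable_law_fst (X i) x (measurableSet_singleton 0)).compl)
  · exact measurableSet_setOfPred.1 (measurableSet_eq_fun
      ((measurable_law_fst _ _).div (measurable_law_fst _ _))
      ((measurable_law_snd _ _).div (measurable_law_snd _ _)))

/-- Restriction of a measurable function to the pairs of Markov chains with equal transition
probabilities. -/
def restrict (X : Fin n → DiscreteRV.{u, v} Ω) (f : Meas (ACPair Ω)) :
    Meas (RestrictedPair X) :=
  ⟨fun p => f.1 p.1, f.2.comp measurable_subtype_coe⟩

open Classical in
/-- The extension by zero of a measurable function on the restricted pairs. -/
def extend (X : Fin n → DiscreteRV.{u, v} Ω) (f : Meas (RestrictedPair X)) :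
    Meas (ACPair Ω) :=
  ⟨fun p => if h : EqualTransitions X p then f.1 ⟨p, h⟩ else 0,
    Measurable.dite (s := {p : ACPair Ω | EqualTransitions X p}) (f := f.1) (g := fun _ => 0)
      f.2 measurable_const (measurableSet_equalTransitions X)⟩

/-- The action of the joint variable `X_A` on measurable functions on the restricted pairs:
extend to all pairs, act there, and restrict again. (Conditioning on a value `y` of `X_A` with
`P(y) ≠ 0` stays inside the restricted pairs, so the choice of extension is immaterial.) -/
def actR (X : Fin n → DiscreteRV.{u, v} Ω) (A : Finset (Fin n)) (f : Meas (RestrictedPair X)) :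
    Meas (RestrictedPair X) :=
  restrict X (act (jointOn X A) (extend X f))

/-- The restricted Kullback-Leibler divergence of the joint variable `X_A`. -/
def klR (X : Fin n → DiscreteRV.{u, v} Ω) (A : Finset (Fin n)) : Meas (RestrictedPair X) :=
  restrict X (kl (jointOn X A))

/-- The higher-order terms `KL_q(X_{L 1}; …; X_{L q})` (with `q + 1` in place of `q`), given by
`KL_1 = KL` and `KL_{q+1}(Y_1; …; Y_{q+1}) = KL_q(Y_1; …; Y_q) - Y_{q+1}.KL_q(Y_1; …; Y_q)`. -/
def klInteraction (X : Fin n → DiscreteRV.{u, v} Ω) :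
    (q : ℕ) → (Fin (q + 1) → Finset (Fin n)) → Meas (RestrictedPair X)
  | 0, L => klR X (L 0)
  | q + 1, L =>
      klInteraction X q (fun k => L k.castSucc) -
        actR X (L (Fin.last (q + 1))) (klInteraction X q (fun k => L k.castSucc))

/-! ### The diagram -/

/-- The atoms `p_I` of the diagram of `n` variables, for nonempty sets `I` of indices. -/
abbrev Atom (n : ℕ) : Type := {I : Finset (Fin n) // I.Nonempty}

/-- The region of the joint variable `X_A`: the union of the circles of the `X i` with `i ∈ A`,
where the circle of `X i` consists of the atoms `p_I` with `i ∈ I`. -/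
def region (A : Finset (Fin n)) : Set (Atom n) := {p | ∃ i ∈ A, i ∈ p.1}

/-- Group-valued measures on the power set of `S`. -/
def IsGroupMeasure {S : Type*} {G : Type*} [AddCommGroup G] (μ : Set S → G) : Prop :=
  ∀ A B : Set S, Disjoint A B → μ (A ∪ B) = μ A + μ B

/-- `μ` is the group-valued measure of the diagram of the restricted Kullback-Leibler divergence:
`X_J.KL_q(X_{L 1}; …; X_{L q}) = μ (⋂ k, region (L k) \ region J)` for all `q ≥ 1` and all
`J, L 1, …, L q`. -/
def IsKLDiagram (X : Fin n → DiscreteRV.{u, v} Ω) (μ : Set (Atom n) → Meas (RestrictedPair X)) :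
    Prop :=
  IsGroupMeasure μ ∧
    ∀ (q : ℕ) (J : Finset (Fin n)) (L : Fin (q + 1) → Finset (Fin n)),
      actR X J (klInteraction X q L) = μ ((⋂ k, region (L k)) \ region J)

end

end KLDiagram

/-! Uniqueness is set theory: each singleton atom has the form `(⋂ k, region (L k)) \ region J`, so
the required identities fix μ on atoms and hence everywhere.

Existence is Hu's theorem. Möbius inversion gives a measure with `μ (region A) = klR X A - klR X ∅`.
The chain rule KL(X_A, X_B) = KL(X_A) + X_A.KL(X_B) (`klR_union`) settles q = 1, and X_A.(X_B.f) =
X_{A ∪ B}.f (`actR_actR`) drives the induction on q. Both need conditioning to stay among the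
restricted pairs (`EqualTransitions.condPair`).

Vanishing comes from `klR_insert`. If j is the successor of i ∈ J, the past factors out of P(x_j |
x_J), and what remains is determined by transitions after x_i, which P and Q share; so X_J.KL(X_j) =
0. Let j ∈ I and i ∉ I. Taking J = Iᶜ, the atoms p_K with j ∈ K ⊆ I sum to zero, and strong
induction on I kills p_I. Only nonempty sets closed under predecessors escape, and these are the
initial segments. -/

namespace KLDiagram

/-! ### Joint probabilities and marginalization -/

section Mass

variable {Ω : Type u} [Fintype Ω] {n : ℕ} (X : Fin n → DiscreteRV.{u, v} Ω)

/-- The value of `X_A` given by an assignment of values to all variables. -/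
def point (A : Finset (Fin n)) (x : ∀ i, (X i).Val) : (jointOn X A).Val := fun i : A => x i

/-- The probability that `X a = x a` for all `a ∈ A`. -/
noncomputable def mass (P : Simplex Ω) (A : Finset (Fin n)) (x : ∀ i, (X i).Val) : ℝ :=
  law P (jointOn X A) (point X A x)

variable {X}

theorem jointOn_eq_iff {Ω : Type u} {n : ℕ} {X : Fin n → DiscreteRV.{u, v} Ω}
    {A : Finset (Fin n)} {x : ∀ i, (X i).Val} {ω : Ω} :
    (jointOn X A).toFun ω = point X A x ↔ ∀ a ∈ A, (X a).toFun ω = x a := by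
  constructor
  · intro h a ha
    exact congrFun h ⟨a, ha⟩
  · intro h
    exact funext fun a : A => h a.1 a.2

open Classical in
theorem mass_eq_sum (P : Simplex Ω) (A : Finset (Fin n)) (x : ∀ i, (X i).Val) :
    mass X P A x = ∑ ω, if ∀ a ∈ A, (X a).toFun ω = x a then P.1 ω else 0 := by
  refine Finset.sum_congr rfl fun ω _ => ?_
  exact if_congr jointOn_eq_iff rfl rfl

theorem law_eq_mass {P : Simplex Ω} {A : Finset (Fin n)} {x : ∀ i, (X i).Val}
    {Y : DiscreteRV.{u, v} Ω} {y : Y.Val}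
    (h : ∀ ω, Y.toFun ω = y ↔ ∀ a ∈ A, (X a).toFun ω = x a) : law P Y y = mass X P A x := by
  classical
  rw [mass_eq_sum]
  exact Finset.sum_congr rfl fun ω _ => if_congr (h ω) rfl rfl

theorem mass_nonneg (P : Simplex Ω) (A : Finset (Fin n)) (x : ∀ i, (X i).Val) :
    0 ≤ mass X P A x :=
  law_nonneg _ _ _

theorem mass_congr {P : Simplex Ω} {A : Finset (Fin n)} {x y : ∀ i, (X i).Val}
    (h : ∀ a ∈ A, x a = y a) : mass X P A x = mass X P A y := by
  have : point X A x = point X A y := funext fun a : A => h a.1 a.2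
  rw [mass, mass, this]

theorem mass_anti {P : Simplex Ω} {A B : Finset (Fin n)} (h : A ⊆ B) (x : ∀ i, (X i).Val) :
    mass X P B x ≤ mass X P A x := by
  classical
  rw [mass_eq_sum, mass_eq_sum]
  refine Finset.sum_le_sum fun ω _ => ?_
  split_ifs with h1 h2 h2
  · exact le_rfl
  · exact absurd (fun a ha => h1 a (h ha)) h2
  · exact P.2.1 ω
  · exact le_rfl

theorem mass_eq_zero_of_subset {P : Simplex Ω} {A B : Finset (Fin n)} (h : A ⊆ B)
    {x : ∀ i, (X i).Val} (h0 : mass X P A x = 0) : mass X P B x = 0 :=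
  le_antisymm ((mass_anti h x).trans h0.le) (mass_nonneg _ _ _)

theorem sum_mass_update {P : Simplex Ω} {A : Finset (Fin n)} {k : Fin n} (hk : k ∉ A)
    (x : ∀ i, (X i).Val) :
    ∑ v, mass X P (insert k A) (Function.update x k v) = mass X P A x := by
  classical
  simp only [mass_eq_sum]
  rw [Finset.sum_comm]
  refine Finset.sum_congr rfl fun ω _ => ?_
  have h : ∀ v : (X k).Val, (∀ a ∈ insert k A, (X a).toFun ω = Function.update x k v a) ↔
      (X k).toFun ω = v ∧ ∀ a ∈ A, (X a).toFun ω = x a := by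
    intro v
    rw [Finset.forall_mem_insert, Function.update_self]
    refine and_congr_right fun _ => forall₂_congr fun a ha => ?_
    rw [Function.update_of_ne (fun h : a = k => hk (h ▸ ha))]
  simp only [h, ite_and]
  rw [Finset.sum_ite_eq]
  simp

/-- Marginalization of a product identity over the variables in `S`. -/
theorem mass_mul_eq_of_union {P Q : Simplex Ω} {B B' S : Finset (Fin n)}
    {c c' : (∀ i, (X i).Val) → ℝ} (hB : Disjoint B S) (hB' : Disjoint B' S)
    (hc : ∀ x y, (∀ a, a ∉ S → x a = y a) → c x = c y)
    (hc' : ∀ x y, (∀ a, a ∉ S → x a = y a) → c' x = c' y)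
    (h : ∀ x, mass X P (B ∪ S) x * c x = mass X Q (B' ∪ S) x * c' x) (x : ∀ i, (X i).Val) :
    mass X P B x * c x = mass X Q B' x * c' x := by
  induction S using Finset.induction_on generalizing x with
  | empty => simpa using h x
  | insert k S hk ih =>
    rw [Finset.disjoint_insert_right] at hB hB'
    have hupd : ∀ (x : ∀ i, (X i).Val) (v : (X k).Val) (a : Fin n), a ∉ insert k S →
        Function.update x k v a = x a := fun x v a ha =>
      Function.update_of_ne (fun h : a = k => ha (h ▸ Finset.mem_insert_self k S)) _ _
    refine ih hB.2 hB'.2 (fun x y hxy => hc x y fun a ha => hxy a ?_)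
      (fun x y hxy => hc' x y fun a ha => hxy a ?_) (fun x => ?_) x
    · exact fun h => ha (Finset.mem_insert_of_mem h)
    · exact fun h => ha (Finset.mem_insert_of_mem h)
    -- Sum the hypothesis over all values of `X k`: `c` and `c'` ignore that coordinate and leave
    -- the sum.
    · rw [← sum_mass_update (k := k) (A := B ∪ S) (by simp [hB.1, hk]),
        ← sum_mass_update (k := k) (A := B' ∪ S) (by simp [hB'.1, hk]), Finset.sum_mul,
        Finset.sum_mul]
      refine Finset.sum_congr rfl fun v _ => ?_
      have := h (Function.update x k v)
      rwa [Finset.union_insert, Finset.union_insert, hc _ _ (hupd x v),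
        hc' _ _ (hupd x v)] at this

theorem mass_congr_of_disjoint {P : Simplex Ω} {C S : Finset (Fin n)} (h : Disjoint C S)
    (x y : ∀ i, (X i).Val) (hxy : ∀ a, a ∉ S → x a = y a) : mass X P C x = mass X P C y :=
  mass_congr fun a ha => hxy a (Finset.disjoint_left.1 h ha)

theorem Simplex.nonempty (P : Simplex Ω) : Nonempty Ω := by
  by_contra h
  rw [not_nonempty_iff] at h
  have := P.2.2
  simp at this

theorem exists_extension (P : Simplex Ω) {A : Finset (Fin n)} (y : (jointOn X A).Val) :
    ∃ x : ∀ i, (X i).Val, y = point X A x := by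
  obtain ⟨ω⟩ := P.nonempty
  refine ⟨fun i => if h : i ∈ A then y ⟨i, h⟩ else (X i).toFun ω, ?_⟩
  funext (i : A)
  simp [point]

theorem mass_ne_zero_of_absCont {P Q : Simplex Ω} (h : AbsCont P Q) {A : Finset (Fin n)}
    {x : ∀ i, (X i).Val} (hP : mass X P A x ≠ 0) : mass X Q A x ≠ 0 :=
  law_ne_zero_of_absCont h _ _ hP

theorem mass_singleton (P : Simplex Ω) (i : Fin n) (x : ∀ i, (X i).Val) :
    law P (X i) (x i) = mass X P {i} x :=
  law_eq_mass fun ω => by simp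

theorem mass_pair (P : Simplex Ω) (i j : Fin n) (x : ∀ i, (X i).Val) :
    law P ((X j).joint (X i)) (x j, x i) = mass X P {i, j} x :=
  law_eq_mass fun ω => by simp [DiscreteRV.joint, and_comm]

theorem mass_Iic (P : Simplex Ω) (i : Fin n) (x : ∀ i, (X i).Val) :
    law P ((jointOn X (Iio i)).joint (X i)) (point X (Iio i) x, x i) = mass X P (Iic i) x :=
  law_eq_mass fun ω => by
    simp only [DiscreteRV.joint, Prod.mk.injEq]
    rw [jointOn_eq_iff]
    constructor
    · rintro ⟨h1, h2⟩ a ha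
      rcases (Finset.mem_Iic.1 ha).lt_or_eq with h | rfl
      · exact h1 a (Finset.mem_Iio.2 h)
      · exact h2
    · exact fun h => ⟨fun a ha => h a (Finset.mem_Iic.2 (Finset.mem_Iio.1 ha).le),
        h i (Finset.mem_Iic.2 le_rfl)⟩

theorem Iic_succ_eq_insert {i j : Fin n} (hij : (j : ℕ) = i + 1) : Iic j = insert j (Iic i) := by
  ext a
  simp only [Finset.mem_insert, Finset.mem_Iic, Fin.le_def, Fin.ext_iff]
  omega

theorem mass_Iic_succ (P : Simplex Ω) {i j : Fin n} (hij : (j : ℕ) = i + 1)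
    (x : ∀ i, (X i).Val) :
    law P ((X j).joint ((jointOn X (Iio i)).joint (X i))) (x j, point X (Iio i) x, x i) =
      mass X P (Iic j) x :=
  law_eq_mass fun ω => by
    rw [Iic_succ_eq_insert hij, Finset.forall_mem_insert]
    simp only [DiscreteRV.joint, Prod.mk.injEq]
    refine and_congr_right fun _ => ?_
    rw [jointOn_eq_iff]
    constructor
    · rintro ⟨h1, h2⟩ a ha
      rcases (Finset.mem_Iic.1 ha).lt_or_eq with h | rfl
      · exact h1 a (Finset.mem_Iio.2 h)
      · exact h2
    · exact fun h => ⟨fun a ha => h a (Finset.mem_Iic.2 (Finset.mem_Iio.1 ha).le),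
        h i (Finset.mem_Iic.2 le_rfl)⟩

/-- Clearing denominators loses nothing: where P(x_i) = 0, the larger joint masses vanish too. The
product form holds for every x and can therefore be marginalized. -/
theorem isMarkovChain_iff {P : Simplex Ω} :
    IsMarkovChain X P ↔ ∀ i j : Fin n, (j : ℕ) = i + 1 → ∀ x,
      mass X P (Iic j) x * mass X P {i} x = mass X P {i, j} x * mass X P (Iic i) x := by
  have key : ∀ i j : Fin n, (j : ℕ) = i + 1 → ∀ x : ∀ i, (X i).Val,
      (law P ((X j).joint ((jointOn X (Iio i)).joint (X i))) (x j, point X (Iio i) x, x i) =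
        condLaw P (X j) (X i) (x j) (x i) *
          law P ((jointOn X (Iio i)).joint (X i)) (point X (Iio i) x, x i)) ↔
      mass X P (Iic j) x * mass X P {i} x = mass X P {i, j} x * mass X P (Iic i) x := by
    intro i j hij x
    rw [condLaw, mass_Iic_succ P hij, mass_Iic, mass_pair, mass_singleton]
    by_cases h0 : mass X P {i} x = 0
    · have h1 : mass X P (Iic i) x = 0 := mass_eq_zero_of_subset (by simp) h0
      have h2 : mass X P (Iic j) x = 0 :=
        mass_eq_zero_of_subset (by simp [Fin.le_def, hij]) h0
      simp [h1, h2]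
    · field_simp
  constructor
  · intro h i j hij x
    exact (key i j hij x).1 (h i j hij _ _ _)
  · intro h i j hij a y b
    obtain ⟨x, rfl⟩ := exists_extension P y
    have hlt : i < j := by rw [Fin.lt_def]; omega
    have e : point X (Iio i) x =
        point X (Iio i) (Function.update (Function.update x i b) j a) := by
      funext (k : Iio i)
      unfold point
      have hk := Finset.mem_Iio.1 k.2
      rw [Function.update_of_ne (hk.trans hlt).ne, Function.update_of_ne hk.ne]
    have := (key i j hij (Function.update (Function.update x i b) j a)).2 (h i j hij _)
    rw [← e, Function.update_self, Function.update_of_ne hlt.ne, Function.update_self] at this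
    exact this

theorem equalTransitions_iff {p : ACPair Ω} :
    EqualTransitions X p ↔ IsMarkovChain X p.1.1 ∧ IsMarkovChain X p.1.2 ∧
      ∀ i j : Fin n, (j : ℕ) = i + 1 → ∀ x, mass X p.1.1 {i} x ≠ 0 →
        mass X p.1.1 {i, j} x * mass X p.1.2 {i} x =
          mass X p.1.2 {i, j} x * mass X p.1.1 {i} x := by
  refine and_congr_right fun _ => and_congr_right fun _ => ?_
  have key : ∀ (i j : Fin n) (x : ∀ i, (X i).Val), mass X p.1.1 {i} x ≠ 0 →
      ((condLaw p.1.1 (X j) (X i) (x j) (x i) = condLaw p.1.2 (X j) (X i) (x j) (x i)) ↔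
        mass X p.1.1 {i, j} x * mass X p.1.2 {i} x =
          mass X p.1.2 {i, j} x * mass X p.1.1 {i} x) := by
    intro i j x hx
    rw [condLaw, condLaw, mass_pair, mass_pair, mass_singleton, mass_singleton,
      div_eq_div_iff hx (mass_ne_zero_of_absCont p.2 hx)]
  constructor
  · intro h i j hij x hx
    exact (key i j x hx).1 (h i j hij _ _ (by rwa [mass_singleton]))
  · intro h i j hij b a hb
    obtain ⟨ω⟩ := p.1.1.nonempty
    have hne : i ≠ j := by rw [Ne, Fin.ext_iff]; omega
    have := key i j (Function.update (Function.update (fun k => (X k).toFun ω) i b) j a)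
    rw [← mass_singleton, Function.update_self, Function.update_of_ne hne,
      Function.update_self] at this
    have h1 := h i j hij (Function.update (Function.update (fun k => (X k).toFun ω) i b) j a)
    rw [← mass_singleton, Function.update_of_ne hne, Function.update_self] at h1
    exact (this hb).2 (h1 hb)

end Mass

/-! ### Markov chains and equal transitions -/

section Markov

variable {Ω : Type u} [Fintype Ω] {n : ℕ} {X : Fin n → DiscreteRV.{u, v} Ω}

/-- The Markov identity at m, with the variables before i summed out. -/
theorem IsMarkovChain.mass_Icc_succ {P : Simplex Ω} (hP : IsMarkovChain X P) {i m j : Fin n}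
    (him : i ≤ m) (hmj : (j : ℕ) = m + 1) (x : ∀ i, (X i).Val) :
    mass X P (Icc i j) x * mass X P {m} x = mass X P (Icc i m) x * mass X P {m, j} x := by
  have hlt : i < j := by rw [Fin.lt_def]; rw [Fin.le_def] at him; omega
  have e1 : Icc i j ∪ Iio i = Iic j := by
    ext a; simp only [mem_union, mem_Icc, mem_Iio, mem_Iic, Fin.le_def, Fin.lt_def] at *; omega
  have e2 : Icc i m ∪ Iio i = Iic m := by
    ext a; simp only [mem_union, mem_Icc, mem_Iio, mem_Iic, Fin.le_def, Fin.lt_def] at *; omega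
  have d : ∀ k, Disjoint (Icc i k) (Iio i) := fun k => Finset.disjoint_left.2 fun a ha hb =>
    absurd (Finset.mem_Icc.1 ha).1 (not_le.2 (Finset.mem_Iio.1 hb))
  refine mass_mul_eq_of_union (S := Iio i) (c := fun x => mass X P {m} x)
    (c' := fun x => mass X P {m, j} x) (d j) (d m)
    (mass_congr_of_disjoint ?_) (mass_congr_of_disjoint ?_) (fun x => ?_) x
  · simpa using him
  · simp [him, hlt.le]
  · rw [e1, e2, isMarkovChain_iff.1 hP m j hmj x, mul_comm]

theorem IsMarkovChain.mass_Iic_mul {P : Simplex Ω} (hP : IsMarkovChain X P) {i m : Fin n}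
    (him : i ≤ m) (x : ∀ i, (X i).Val) :
    mass X P (Iic m) x * mass X P {i} x = mass X P (Iic i) x * mass X P (Icc i m) x := by
  obtain ⟨m, hm⟩ := m
  change (i : ℕ) ≤ m at him
  induction m, him using Nat.le_induction with
  | base => simp
  | succ m him ih =>
    have ih := ih (by omega)
    set k : Fin n := ⟨m, by omega⟩
    have hik : i ≤ k := him
    have h1 := isMarkovChain_iff.1 hP k ⟨m + 1, hm⟩ rfl x
    have h2 := hP.mass_Icc_succ (j := ⟨m + 1, hm⟩) hik rfl x
    by_cases h0 : mass X P {k} x = 0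
    · rw [mass_eq_zero_of_subset (B := Iic ⟨m + 1, hm⟩) (by simp [Fin.le_def, k]) h0,
        mass_eq_zero_of_subset (B := Icc i ⟨m + 1, hm⟩)
          (by simpa [Fin.le_def, k] using him) h0]
      ring
    · apply mul_right_cancel₀ h0
      linear_combination mass X P {i} x * h1 - mass X P (Iic i) x * h2 +
        mass X P {k, ⟨m + 1, hm⟩} x * ih

/-- The past and the future of a Markov chain are independent given the present. -/
theorem IsMarkovChain.mass_union_mul {P : Simplex Ω} (hP : IsMarkovChain X P) {i : Fin n}
    {A B : Finset (Fin n)} (hA : A ⊆ Iic i) (hB : B ⊆ Ici i) (hiA : i ∈ A) (hiB : i ∈ B)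
    (x : ∀ i, (X i).Val) :
    mass X P (A ∪ B) x * mass X P {i} x = mass X P A x * mass X P B x := by
  -- Prove it for the full past and the full future, then sum out `Iic i \ A` and `Ici i \ B`. The
  -- last index is `n - 1`.
  have h0 : ∀ x, mass X P (Iic i ∪ Ici i) x * mass X P {i} x =
      mass X P (Iic i) x * mass X P (Ici i) x := by
    intro x
    have hn : n - 1 < n := by have := i.2; omega
    have him : i ≤ ⟨n - 1, hn⟩ := by rw [Fin.le_def]; have := i.2; simp only; omega
    have e1 : Iic i ∪ Ici i = Iic ⟨n - 1, hn⟩ := by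
      ext a
      simp only [mem_union, mem_Iic, mem_Ici, Fin.le_def]
      omega
    have e2 : Ici i = Icc i ⟨n - 1, hn⟩ := by
      ext a
      simp only [mem_Icc, mem_Ici, Fin.le_def]
      omega
    rw [e1, e2]
    exact hP.mass_Iic_mul him x
  have h1 : ∀ x, mass X P (A ∪ Ici i) x * mass X P {i} x =
      mass X P A x * mass X P (Ici i) x := by
    have d : Disjoint (Ici i) (Iic i \ A) := by
      rw [Finset.disjoint_left]
      intro a ha hb
      simp only [mem_Ici, mem_sdiff, mem_Iic] at ha hb
      exact hb.2 (le_antisymm hb.1 ha ▸ hiA)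
    refine mass_mul_eq_of_union (S := Iic i \ A) (c := fun x => mass X P {i} x)
      (c' := fun x => mass X P (Ici i) x)
      (Finset.disjoint_union_left.2 ⟨Finset.disjoint_sdiff, d⟩) Finset.disjoint_sdiff
      (mass_congr_of_disjoint (Finset.disjoint_singleton_left.2 (by simp [hiA])))
      (mass_congr_of_disjoint d) fun x => ?_
    rw [Finset.union_right_comm, Finset.union_sdiff_of_subset hA]
    exact h0 x
  have d : Disjoint A (Ici i \ B) := by
    rw [Finset.disjoint_left]
    intro a ha hb
    have ha := hA ha
    simp only [mem_Ici, mem_sdiff, mem_Iic] at ha hb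
    exact hb.2 (le_antisymm ha hb.1 ▸ hiB)
  rw [mul_comm (mass X P A x)]
  refine mass_mul_eq_of_union (S := Ici i \ B) (c := fun x => mass X P {i} x)
    (c' := fun x => mass X P A x)
    (Finset.disjoint_union_left.2 ⟨d, Finset.disjoint_sdiff⟩) Finset.disjoint_sdiff
    (mass_congr_of_disjoint (Finset.disjoint_singleton_left.2 (by simp [hiB])))
    (mass_congr_of_disjoint d) (fun x => ?_) x
  rw [Finset.union_assoc, Finset.union_sdiff_of_subset hB, h1, mul_comm]

/-- Given x_i, both path probabilities are products of the same transitions. -/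
theorem EqualTransitions.mass_Icc_mul {p : ACPair Ω} (hp : EqualTransitions X p) {i m : Fin n}
    (him : i ≤ m) {x : ∀ i, (X i).Val} (hx : mass X p.1.1 {i} x ≠ 0) :
    mass X p.1.1 (Icc i m) x * mass X p.1.2 {i} x =
      mass X p.1.2 (Icc i m) x * mass X p.1.1 {i} x := by
  obtain ⟨m, hm⟩ := m
  change (i : ℕ) ≤ m at him
  induction m, him using Nat.le_induction with
  | base => simp [mul_comm]
  | succ m him ih =>
    have ih := ih (by omega)
    set k : Fin n := ⟨m, by omega⟩
    have hik : i ≤ k := him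
    have hs : Icc i k ⊆ Icc i ⟨m + 1, hm⟩ := Finset.Icc_subset_Icc_right (by simp [k])
    have hQ := mass_ne_zero_of_absCont p.2 hx
    -- Equality of transitions from x_k is available only for P(x_k) ≠ 0. If the path up to k is
    -- P-null, the induction hypothesis makes it Q-null, so both sides vanish.
    by_cases h0 : mass X p.1.1 (Icc i k) x = 0
    · have h1 : mass X p.1.2 (Icc i k) x = 0 := by
        rw [h0, zero_mul] at ih
        exact (mul_eq_zero.1 ih.symm).resolve_right hx
      rw [mass_eq_zero_of_subset hs h0, mass_eq_zero_of_subset hs h1, zero_mul, zero_mul]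
    · have hk : mass X p.1.1 {k} x ≠ 0 := fun h =>
        h0 (mass_eq_zero_of_subset (by simpa using hik) h)
      have hkQ := mass_ne_zero_of_absCont p.2 hk
      have h1 := hp.1.mass_Icc_succ (j := ⟨m + 1, hm⟩) hik rfl x
      have h2 := hp.2.1.mass_Icc_succ (j := ⟨m + 1, hm⟩) hik rfl x
      have h3 := (equalTransitions_iff.1 hp).2.2 k ⟨m + 1, hm⟩ rfl x hk
      apply mul_right_cancel₀ (mul_ne_zero hk hkQ)
      linear_combination mass X p.1.2 {i} x * mass X p.1.2 {k} x * h1 -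
        mass X p.1.1 {i} x * mass X p.1.1 {k} x * h2 +
        mass X p.1.2 {k} x * mass X p.1.1 {k, ⟨m + 1, hm⟩} x * ih +
        mass X p.1.2 (Icc i k) x * mass X p.1.1 {i} x * h3

/-- The conditional law of the future given the present agrees for both distributions. -/
theorem EqualTransitions.mass_future_mul {p : ACPair Ω} (hp : EqualTransitions X p) {i : Fin n}
    {B : Finset (Fin n)} (hB : B ⊆ Ici i) (hi : i ∈ B) {x : ∀ i, (X i).Val}
    (hx : mass X p.1.1 {i} x ≠ 0) :
    mass X p.1.1 B x * mass X p.1.2 {i} x = mass X p.1.2 B x * mass X p.1.1 {i} x := by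
  have hn : n - 1 < n := by have := i.2; omega
  have him : i ≤ ⟨n - 1, hn⟩ := by rw [Fin.le_def]; have := i.2; simp only; omega
  have e2 : Ici i = Icc i ⟨n - 1, hn⟩ := by
    ext a
    simp only [mem_Icc, mem_Ici, Fin.le_def]
    omega
  have d : Disjoint {i} (Ici i \ B) := Finset.disjoint_singleton_left.2 (by simp [hi])
  -- Marginalization needs an identity for all x. The extra factor P(x_i) makes it trivial where
  -- P(x_i) = 0; it is cancelled at the end.
  have key : mass X p.1.1 B x * (mass X p.1.2 {i} x * mass X p.1.1 {i} x) =
      mass X p.1.2 B x * (mass X p.1.1 {i} x * mass X p.1.1 {i} x) := by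
    refine mass_mul_eq_of_union (S := Ici i \ B)
      (c := fun x => mass X p.1.2 {i} x * mass X p.1.1 {i} x)
      (c' := fun x => mass X p.1.1 {i} x * mass X p.1.1 {i} x)
      Finset.disjoint_sdiff Finset.disjoint_sdiff (fun x y h => ?_) (fun x y h => ?_)
      (fun x => ?_) x
    · simp only [mass_congr_of_disjoint d x y h]
    · simp only [mass_congr_of_disjoint d x y h]
    · rw [Finset.union_sdiff_of_subset hB, e2]
      by_cases h0 : mass X p.1.1 {i} x = 0
      · simp [h0]
      · rw [← mul_assoc, ← mul_assoc, hp.mass_Icc_mul him h0]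
  apply mul_right_cancel₀ hx
  linear_combination key

/-- Given the value of `X i`, and possibly further variables, the conditional law of the
successor of `X i` agrees for both distributions. -/
theorem EqualTransitions.mass_insert_mul {p : ACPair Ω} (hp : EqualTransitions X p)
    {i j : Fin n} (hij : (j : ℕ) = i + 1) {J : Finset (Fin n)} (hi : i ∈ J)
    {x : ∀ i, (X i).Val} (hx : mass X p.1.1 J x ≠ 0) :
    mass X p.1.1 (insert j J) x * mass X p.1.2 J x =
      mass X p.1.2 (insert j J) x * mass X p.1.1 J x := by
  have hlt : i < j := by rw [Fin.lt_def]; omega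
  have hPi : mass X p.1.1 {i} x ≠ 0 := fun h => hx (mass_eq_zero_of_subset (by simpa) h)
  have hQi := mass_ne_zero_of_absCont p.2 hPi
  -- Split J at i. The new index j joins the future half, and the past factors are common to both
  -- sides.
  have e1 : J ∩ Iic i ∪ J ∩ Ici i = J := by
    rw [← Finset.inter_union_distrib_left, Finset.inter_eq_left]
    intro a _
    simp [le_total]
  have e2 : J ∩ Iic i ∪ insert j (J ∩ Ici i) = insert j J := by
    rw [Finset.union_insert, e1]
  have s1 : J ∩ Iic i ⊆ Iic i := Finset.inter_subset_right
  have s2 : J ∩ Ici i ⊆ Ici i := Finset.inter_subset_right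
  have s3 : insert j (J ∩ Ici i) ⊆ Ici i := Finset.insert_subset (by simpa using hlt.le) s2
  have m1 : i ∈ J ∩ Iic i := by simp [hi]
  have m2 : i ∈ J ∩ Ici i := by simp [hi]
  have m3 : i ∈ insert j (J ∩ Ici i) := Finset.mem_insert_of_mem m2
  have p1 := hp.1.mass_union_mul s1 s2 m1 m2 x
  have p2 := hp.1.mass_union_mul s1 s3 m1 m3 x
  have q1 := hp.2.1.mass_union_mul s1 s2 m1 m2 x
  have q2 := hp.2.1.mass_union_mul s1 s3 m1 m3 x
  rw [e1] at p1 q1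
  rw [e2] at p2 q2
  have g1 := hp.mass_future_mul s2 m2 hPi
  have g2 := hp.mass_future_mul s3 m3 hPi
  have g : mass X p.1.1 (insert j (J ∩ Ici i)) x * mass X p.1.2 (J ∩ Ici i) x =
      mass X p.1.2 (insert j (J ∩ Ici i)) x * mass X p.1.1 (J ∩ Ici i) x := by
    apply mul_right_cancel₀ (mul_ne_zero hPi hQi)
    linear_combination mass X p.1.2 (J ∩ Ici i) x * mass X p.1.1 {i} x * g2 -
      mass X p.1.2 (insert j (J ∩ Ici i)) x * mass X p.1.1 {i} x * g1
  have p12 : mass X p.1.1 (insert j J) x * mass X p.1.1 {i} x *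
      (mass X p.1.2 J x * mass X p.1.2 {i} x) =
      mass X p.1.2 (insert j J) x * mass X p.1.2 {i} x *
      (mass X p.1.1 J x * mass X p.1.1 {i} x) := by
    rw [p1, p2, q1, q2]
    linear_combination mass X p.1.1 (J ∩ Iic i) x * mass X p.1.2 (J ∩ Iic i) x * g
  apply mul_right_cancel₀ (mul_ne_zero hPi hQi)
  linear_combination p12

end Markov

/-! ### Stability of the restricted pairs under conditioning -/

section Conditioning

variable {Ω : Type u} [Fintype Ω] {n : ℕ} {X : Fin n → DiscreteRV.{u, v} Ω}

theorem mass_cond {P : Simplex Ω} {A B : Finset (Fin n)} {x : ∀ i, (X i).Val}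
    (h : law P (jointOn X A) (point X A x) ≠ 0) :
    mass X (cond P (jointOn X A) _ h) B x = mass X P (A ∪ B) x / mass X P A x := by
  classical
  rw [mass_eq_sum, mass_eq_sum, Finset.sum_div]
  refine Finset.sum_congr rfl fun ω _ => ?_
  simp only [cond, jointOn_eq_iff, Finset.forall_mem_union]
  by_cases h1 : ∀ a ∈ A, (X a).toFun ω = x a <;> by_cases h2 : ∀ a ∈ B, (X a).toFun ω = x a
  · rw [if_pos h2, if_pos h1, if_pos ⟨h1, h2⟩, mass]
  · simp [h2]
  · simp [h1]
  · simp [h1]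

theorem mass_cond_eq_zero {P : Simplex Ω} {A B : Finset (Fin n)} {y : (jointOn X A).Val}
    {x : ∀ i, (X i).Val} (h : law P (jointOn X A) y ≠ 0) {k : Fin n} (hA : k ∈ A) (hB : k ∈ B)
    (hk : x k ≠ y ⟨k, hA⟩) : mass X (cond P (jointOn X A) y h) B x = 0 := by
  classical
  rw [mass_eq_sum]
  refine Finset.sum_eq_zero fun ω _ => ?_
  split_ifs with h1
  · simp only [cond]
    rw [if_neg, zero_div]
    rintro rfl
    exact hk (h1 k hB).symm
  · rfl

/-- An assignment that agrees with `y` on `A` and with `x` elsewhere. -/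
theorem exists_agree {Ω : Type u} {n : ℕ} {X : Fin n → DiscreteRV.{u, v} Ω}
    {A B : Finset (Fin n)} (y : (jointOn X A).Val) (x : ∀ i, (X i).Val)
    (h : ∀ (k : Fin n) (hA : k ∈ A), k ∈ B → x k = y ⟨k, hA⟩) :
    ∃ z : ∀ i, (X i).Val, y = point X A z ∧ ∀ k ∈ B, x k = z k := by
  refine ⟨fun k => if hk : k ∈ A then y ⟨k, hk⟩ else x k, ?_, fun k hk => ?_⟩
  · funext (i : A)
    simp [point]
  · dsimp only
    split_ifs with hA
    · exact h k hA hk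
    · rfl

/-- Conditioned masses are quotients of masses of A ∪ B. Splitting each such set at i into past and
future, the same two past factors and the same two future factors occur on both sides. -/
theorem IsMarkovChain.cond {P : Simplex Ω} (hP : IsMarkovChain X P) {A : Finset (Fin n)}
    {y : (jointOn X A).Val} (h : law P (jointOn X A) y ≠ 0) :
    IsMarkovChain X (cond P (jointOn X A) y h) := by
  rw [isMarkovChain_iff]
  intro i j hij x
  have hlt : i < j := by rw [Fin.lt_def]; omega
  -- If x contradicts the conditioning value y somewhere on `Iic j`, both sides are zero.
  by_cases hag : ∀ (k : Fin n) (hA : k ∈ A), k ∈ Iic j → x k = y ⟨k, hA⟩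
  · obtain ⟨z, rfl, hz⟩ := exists_agree y x hag
    have s1 : {i} ⊆ Iic j := by simpa using hlt.le
    have s2 : {i, j} ⊆ Iic j := by simp [Finset.insert_subset_iff, hlt.le]
    have s3 : Iic i ⊆ Iic j := Finset.Iic_subset_Iic.2 hlt.le
    rw [mass_congr hz, mass_congr fun a ha => hz a (s1 ha), mass_congr fun a ha => hz a (s2 ha),
      mass_congr fun a ha => hz a (s3 ha), mass_cond, mass_cond, mass_cond, mass_cond]
    have h0 : mass X P A z ≠ 0 := h
    have e1 : A ∪ Iic j = Iic i ∪ (insert i (insert j (A ∩ Ici i))) := by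
      rw [Iic_succ_eq_insert hij]
      ext a
      simp only [mem_union, mem_insert, mem_Iic, mem_inter, mem_Ici]
      have := le_total a i
      have : a = i → a ≤ i := fun h => h.le
      tauto
    have e2 : A ∪ {i} = insert i (A ∩ Iic i) ∪ insert i (A ∩ Ici i) := by
      ext a
      simp only [mem_union, mem_insert, mem_Iic, mem_inter, mem_Ici, mem_singleton]
      have := le_total a i
      tauto
    have e3 : A ∪ {i, j} = insert i (A ∩ Iic i) ∪ insert i (insert j (A ∩ Ici i)) := by
      ext a
      simp only [mem_union, mem_insert, mem_Iic, mem_inter, mem_Ici, mem_singleton]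
      have := le_total a i
      tauto
    have e4 : A ∪ Iic i = Iic i ∪ insert i (A ∩ Ici i) := by
      ext a
      simp only [mem_union, mem_insert, mem_Iic, mem_inter, mem_Ici]
      have := le_total a i
      have : a = i → a ≤ i := fun h => h.le
      tauto
    have t1 : insert i (A ∩ Iic i) ⊆ Iic i :=
      Finset.insert_subset (by simp) Finset.inter_subset_right
    have t2 : insert i (A ∩ Ici i) ⊆ Ici i :=
      Finset.insert_subset (by simp) Finset.inter_subset_right
    have t3 : insert i (insert j (A ∩ Ici i)) ⊆ Ici i :=
      Finset.insert_subset (by simp)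
        (Finset.insert_subset (by simpa using hlt.le) Finset.inter_subset_right)
    have c1 := hP.mass_union_mul (Finset.Subset.refl (Iic i)) t3 (by simp) (by simp) z
    have c2 := hP.mass_union_mul t1 t2 (by simp) (by simp) z
    have c3 := hP.mass_union_mul t1 t3 (by simp) (by simp) z
    have c4 := hP.mass_union_mul (Finset.Subset.refl (Iic i)) t2 (by simp) (by simp) z
    rw [← e1] at c1
    rw [← e2] at c2
    rw [← e3] at c3
    rw [← e4] at c4
    by_cases hi : mass X P {i} z = 0
    · rw [mass_eq_zero_of_subset (B := A ∪ {i}) (by simp) hi,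
        mass_eq_zero_of_subset (B := A ∪ {i, j}) (by simp) hi]
      ring
    · have : mass X P (A ∪ Iic j) z * mass X P (A ∪ {i}) z =
          mass X P (A ∪ {i, j}) z * mass X P (A ∪ Iic i) z := by
        apply mul_right_cancel₀ (mul_ne_zero hi hi)
        rw [mul_mul_mul_comm, c1, c2, mul_mul_mul_comm (mass X P (A ∪ {i, j}) z), c3, c4]
        ring
      field_simp
      exact this
  · push Not at hag
    obtain ⟨k, hA, hk, hne⟩ := hag
    rw [mass_cond_eq_zero h hA hk hne, zero_mul]
    rw [Iic_succ_eq_insert hij, Finset.mem_insert] at hk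
    rcases hk with rfl | hk
    · rw [mass_cond_eq_zero h hA (by simp) hne, zero_mul]
    · rw [mass_cond_eq_zero h hA hk hne, mul_zero]

/-- Conditioning on a value of `X_A` stays inside the restricted pairs. -/
theorem EqualTransitions.condPair {p : ACPair Ω} (hp : EqualTransitions X p)
    (A : Finset (Fin n)) (y : (jointOn X A).Val) :
    EqualTransitions X (condPair (jointOn X A) y p) := by
  unfold KLDiagram.condPair
  split_ifs with h
  · have hQ := law_ne_zero_of_absCont p.2 _ y h
    rw [equalTransitions_iff]
    refine ⟨hp.1.cond h, hp.2.1.cond hQ, fun i j hij x hx => ?_⟩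
    dsimp only at hx ⊢
    by_cases hag : ∀ (k : Fin n) (hA : k ∈ A), k ∈ ({i, j} : Finset (Fin n)) → x k = y ⟨k, hA⟩
    · obtain ⟨z, rfl, hz⟩ := exists_agree y x hag
      have hzi : ∀ a ∈ ({i} : Finset (Fin n)), x a = z a := fun a ha => hz a (by simp_all)
      rw [mass_congr hzi, mass_cond] at hx
      rw [mass_congr hzi, mass_congr hz, mass_congr hzi, mass_congr hz, mass_cond, mass_cond,
        mass_cond, mass_cond]
      have hx' : mass X p.1.1 (A ∪ {i}) z ≠ 0 := fun h0 => hx (by rw [h0, zero_div])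
      -- A may contain indices on both sides of i, so agreement of the transition from x_i alone
      -- would not suffice.
      have := hp.mass_insert_mul hij (J := A ∪ {i}) (by simp) hx'
      have e : A ∪ {i, j} = insert j (A ∪ {i}) := by
        ext a
        simp only [mem_union, mem_insert, mem_singleton]
        tauto
      rw [e, div_mul_div_comm, div_mul_div_comm, this, mul_comm (mass X p.1.1 A z)]
    · push Not at hag
      obtain ⟨k, hA, hk, hne⟩ := hag
      rw [mass_cond_eq_zero h hA hk hne, mass_cond_eq_zero hQ hA hk hne, zero_mul, zero_mul]
  · exact hp

end Conditioning

end KLDiagram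

namespace KLDiagram

/-! ### The conditioning action and the chain rule -/

section Action

variable {Ω : Type u} [Fintype Ω] {n : ℕ} {X : Fin n → DiscreteRV.{u, v} Ω}

variable (X) in
/-- The values of all variables at a sample point. -/
def observe (ω : Ω) : ∀ i, (X i).Val := fun i => (X i).toFun ω

/-- Averages over values become averages over sample points. Null points then drop out, and at the
others every observed value has positive probability. -/
theorem sum_law_mul (P : Simplex Ω) (Y : DiscreteRV.{u, v} Ω) (φ : Y.Val → ℝ) :
    ∑ y, law P Y y * φ y = ∑ ω, P.1 ω * φ (Y.toFun ω) := by
  classical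
  simp only [law, Finset.sum_mul]
  rw [Finset.sum_comm]
  refine Finset.sum_congr rfl fun ω _ => ?_
  simp only [ite_mul, zero_mul]
  rw [Finset.sum_ite_eq]
  simp

theorem law_toFun_ne_zero {P : Simplex Ω} {ω : Ω} (h : P.1 ω ≠ 0) (Y : DiscreteRV.{u, v} Ω) :
    law P Y (Y.toFun ω) ≠ 0 := by
  classical
  have h1 : P.1 ω ≤ law P Y (Y.toFun ω) := by
    have := Finset.single_le_sum (s := Finset.univ)
      (f := fun ω' => if Y.toFun ω' = Y.toFun ω then P.1 ω' else 0) (fun ω' _ => by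
        split_ifs
        · exact P.2.1 ω'
        · exact le_rfl) (Finset.mem_univ ω)
    simpa [law] using this
  exact (lt_of_lt_of_le (lt_of_le_of_ne (P.2.1 ω) h.symm) h1).ne'

theorem mass_observe_ne_zero {P : Simplex Ω} {ω : Ω} (h : P.1 ω ≠ 0) (A : Finset (Fin n)) :
    mass X P A (observe X ω) ≠ 0 :=
  law_toFun_ne_zero h (jointOn X A)

theorem kl_jointOn_apply (p : ACPair Ω) (A : Finset (Fin n)) :
    (kl (jointOn X A)).1 p = ∑ ω, p.1.1.1 ω *
      Real.log (mass X p.1.1 A (observe X ω) / mass X p.1.2 A (observe X ω)) :=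
  sum_law_mul p.1.1 (jointOn X A) fun y =>
    Real.log (law p.1.1 (jointOn X A) y / law p.1.2 (jointOn X A) y)

theorem act_apply (Y : DiscreteRV.{u, v} Ω) (f : Meas (ACPair Ω)) (p : ACPair Ω) :
    (act Y f).1 p = ∑ ω, p.1.1.1 ω * f.1 (condPair Y (Y.toFun ω) p) :=
  sum_law_mul p.1.1 Y fun y => f.1 (condPair Y y p)

theorem condPair_of_ne_zero {Y : DiscreteRV.{u, v} Ω} {y : Y.Val} {p : ACPair Ω}
    (h : law p.1.1 Y y ≠ 0) :
    (condPair Y y p).1 = (cond p.1.1 Y y h, cond p.1.2 Y y (law_ne_zero_of_absCont p.2 Y y h)) := by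
  rw [condPair, dif_pos h]

/-- The tower property: averaging conditional averages gives the average. -/
theorem sum_mul_sum_condPair (p : ACPair Ω) (Y : DiscreteRV.{u, v} Ω) (φ : Ω → Ω → ℝ)
    (hφ : ∀ ω ω', p.1.1.1 ω' ≠ 0 → Y.toFun ω' = Y.toFun ω → φ ω ω' = φ ω' ω') :
    ∑ ω, p.1.1.1 ω * ∑ ω', (condPair Y (Y.toFun ω) p).1.1.1 ω' * φ ω ω' =
      ∑ ω, p.1.1.1 ω * φ ω ω := by
  classical
  -- Written this way, the sum over ω at fixed ω' is P(Y = Y(ω')), which cancels the denominator.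
  have h1 : ∀ ω ω', p.1.1.1 ω * ((condPair Y (Y.toFun ω) p).1.1.1 ω' * φ ω ω') =
      (if Y.toFun ω = Y.toFun ω' then p.1.1.1 ω else 0) *
        (p.1.1.1 ω' / law p.1.1 Y (Y.toFun ω') * φ ω' ω') := by
    intro ω ω'
    by_cases h0 : p.1.1.1 ω = 0
    · simp [h0]
    · rw [condPair_of_ne_zero (law_toFun_ne_zero h0 Y)]
      simp only [cond]
      by_cases h2 : Y.toFun ω = Y.toFun ω'
      · rw [if_pos h2, if_pos h2.symm, ← h2]
        by_cases h3 : p.1.1.1 ω' = 0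
        · simp [h3]
        · rw [hφ ω ω' h3 h2.symm]
      · rw [if_neg h2, if_neg (Ne.symm h2)]
        simp
  simp only [Finset.mul_sum, h1]
  rw [Finset.sum_comm]
  refine Finset.sum_congr rfl fun ω' _ => ?_
  rw [← Finset.sum_mul]
  change law p.1.1 Y (Y.toFun ω') * _ = _
  by_cases h3 : p.1.1.1 ω' = 0
  · simp [h3]
  · have := law_toFun_ne_zero h3 Y
    field_simp

/-- Positive mass at ω keeps all three conditionings off the default branch of `condPair`; the
normalizing factor P(x_A) cancels. -/
theorem condPair_condPair {p : ACPair Ω} {ω : Ω} (h : p.1.1.1 ω ≠ 0) (A B : Finset (Fin n)) :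
    condPair (jointOn X B) ((jointOn X B).toFun ω)
        (condPair (jointOn X A) ((jointOn X A).toFun ω) p) =
      condPair (jointOn X (A ∪ B)) ((jointOn X (A ∪ B)).toFun ω) p := by
  classical
  have hA : law p.1.1 (jointOn X A) (point X A (observe X ω)) ≠ 0 := mass_observe_ne_zero h A
  have hAQ := law_ne_zero_of_absCont p.2 _ _ hA
  have hU : law p.1.1 (jointOn X (A ∪ B)) (point X (A ∪ B) (observe X ω)) ≠ 0 :=
    mass_observe_ne_zero h (A ∪ B)
  have hUQ := law_ne_zero_of_absCont p.2 _ _ hU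
  have main : ∀ (P : Simplex Ω) (hP : law P (jointOn X A) (point X A (observe X ω)) ≠ 0)
      (hB : law (cond P (jointOn X A) _ hP) (jointOn X B) (point X B (observe X ω)) ≠ 0)
      (hU : law P (jointOn X (A ∪ B)) (point X (A ∪ B) (observe X ω)) ≠ 0),
      cond (cond P (jointOn X A) _ hP) (jointOn X B) _ hB = cond P (jointOn X (A ∪ B)) _ hU := by
    intro P hP hB hU
    refine Subtype.ext (funext fun ω' => ?_)
    have e : law (cond P (jointOn X A) _ hP) (jointOn X B) (point X B (observe X ω)) =
        law P (jointOn X (A ∪ B)) (point X (A ∪ B) (observe X ω)) /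
          law P (jointOn X A) (point X A (observe X ω)) := mass_cond hP
    simp only [cond] at e ⊢
    rw [e]
    simp only [if_congr jointOn_eq_iff rfl rfl, Finset.forall_mem_union]
    by_cases h1 : ∀ a ∈ A, (X a).toFun ω' = observe X ω a <;>
      by_cases h2 : ∀ a ∈ B, (X a).toFun ω' = observe X ω a
    · rw [if_pos h2, if_pos h1, if_pos ⟨h1, h2⟩]
      field_simp
    · simp [h2]
    · simp [h1]
    · simp [h1]
  have hA' := condPair_of_ne_zero hA
  have hB : law (condPair (jointOn X A) (point X A (observe X ω)) p).1.1 (jointOn X B)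
      (point X B (observe X ω)) ≠ 0 := by
    rw [hA']
    change mass X (cond p.1.1 (jointOn X A) _ hA) B (observe X ω) ≠ 0
    rw [mass_cond]
    exact div_ne_zero hU hA
  refine Subtype.ext ?_
  refine (condPair_of_ne_zero hB).trans ((Prod.ext ?_ ?_).trans (condPair_of_ne_zero hU).symm)
  · have := main p.1.1 hA
    simp only [hA']
    exact this _ hU
  · have := main p.1.2 hAQ
    simp only [hA']
    exact this _ hUQ

/-- Every `condPair`, including its default value, is again a restricted pair, so the extension by
zero never enters. -/
theorem actR_apply (A : Finset (Fin n)) (f : Meas (RestrictedPair X)) (p : RestrictedPair X) :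
    (actR X A f).1 p = ∑ ω, p.1.1.1.1 ω *
      f.1 ⟨condPair (jointOn X A) ((jointOn X A).toFun ω) p.1, p.2.condPair A _⟩ := by
  refine (act_apply (jointOn X A) (extend X f) p.1).trans ?_
  refine Finset.sum_congr rfl fun ω _ => ?_
  congr 1
  exact dif_pos (p.2.condPair A _)

theorem actR_sub (A : Finset (Fin n)) (f g : Meas (RestrictedPair X)) :
    actR X A (f - g) = actR X A f - actR X A g := by
  refine Subtype.ext (funext fun p => ?_)
  change (actR X A (f - g)).1 p = (actR X A f).1 p - (actR X A g).1 p
  rw [actR_apply, actR_apply, actR_apply, ← Finset.sum_sub_distrib]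
  refine Finset.sum_congr rfl fun ω _ => ?_
  rw [← mul_sub]
  rfl

theorem actR_actR (A B : Finset (Fin n)) (f : Meas (RestrictedPair X)) :
    actR X A (actR X B f) = actR X (A ∪ B) f := by
  refine Subtype.ext (funext fun p => ?_)
  rw [actR_apply, actR_apply]
  simp only [actR_apply]
  rw [sum_mul_sum_condPair p.1 (jointOn X A) fun ω ω' =>
    f.1 ⟨condPair (jointOn X B) ((jointOn X B).toFun ω')
      (condPair (jointOn X A) ((jointOn X A).toFun ω) p.1), (p.2.condPair A _).condPair B _⟩]
  · refine Finset.sum_congr rfl fun ω _ => ?_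
    by_cases h : p.1.1.1.1 ω = 0
    · simp [h]
    · simp only [condPair_condPair h]
  · intro ω ω' _ h
    simp only [h]

/-- The chain rule for the Kullback-Leibler divergence. -/
theorem klR_union (A B : Finset (Fin n)) :
    klR X (A ∪ B) = klR X A + actR X A (klR X B) := by
  refine Subtype.ext (funext fun p => ?_)
  change (kl (jointOn X (A ∪ B))).1 p.1 = (kl (jointOn X A)).1 p.1 + (actR X A (klR X B)).1 p
  have h1 : ∀ q : RestrictedPair X, (klR X B).1 q = (kl (jointOn X B)).1 q.1 := fun _ => rfl
  rw [actR_apply]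
  simp only [h1, kl_jointOn_apply]
  rw [sum_mul_sum_condPair p.1 (jointOn X A) fun ω ω' => Real.log
    (mass X (condPair (jointOn X A) ((jointOn X A).toFun ω) p.1).1.1 B (observe X ω') /
      mass X (condPair (jointOn X A) ((jointOn X A).toFun ω) p.1).1.2 B (observe X ω')),
    ← Finset.sum_add_distrib]
  · refine Finset.sum_congr rfl fun ω _ => ?_
    by_cases h : p.1.1.1.1 ω = 0
    · simp [h]
    · have hA := mass_observe_ne_zero (X := X) h A
      have hU := mass_observe_ne_zero (X := X) h (A ∪ B)
      have hAQ := mass_ne_zero_of_absCont p.1.2 hA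
      have hUQ := mass_ne_zero_of_absCont p.1.2 hU
      have e : (jointOn X A).toFun ω = point X A (observe X ω) := rfl
      rw [e, condPair_of_ne_zero hA, mass_cond (P := p.1.1.1) hA, mass_cond (P := p.1.1.2) hAQ,
        ← mul_add,
        ← Real.log_mul (div_ne_zero hA hAQ) (div_ne_zero (div_ne_zero hU hA)
          (div_ne_zero hUQ hAQ))]
      congr 2
      field_simp
  · intro ω ω' _ h
    rw [h]

/-- Adding the successor of a known variable does not change the restricted divergence. -/
theorem klR_insert {i j : Fin n} (hij : (j : ℕ) = i + 1) {J : Finset (Fin n)} (hi : i ∈ J) :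
    klR X (insert j J) = klR X J := by
  refine Subtype.ext (funext fun p => ?_)
  change (kl (jointOn X (insert j J))).1 p.1 = (kl (jointOn X J)).1 p.1
  rw [kl_jointOn_apply, kl_jointOn_apply]
  refine Finset.sum_congr rfl fun ω _ => ?_
  by_cases h : p.1.1.1.1 ω = 0
  · simp [h]
  · have h1 := mass_observe_ne_zero (X := X) h J
    congr 2
    rw [div_eq_div_iff (mass_ne_zero_of_absCont p.1.2 (mass_observe_ne_zero h _))
      (mass_ne_zero_of_absCont p.1.2 h1), p.2.mass_insert_mul hij hi h1, mul_comm]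

end Action

end KLDiagram

namespace KLDiagram

/-! ### Group-valued measures and Möbius inversion -/

section GroupMeasure

variable {S G : Type*} [AddCommGroup G] {μ : Set S → G}

theorem IsGroupMeasure.empty (h : IsGroupMeasure μ) : μ ∅ = 0 := by
  simpa using h ∅ ∅ (Set.disjoint_empty ∅)

theorem IsGroupMeasure.union_eq (h : IsGroupMeasure μ) (A B : Set S) :
    μ (A ∪ B) = μ B + μ (A \ B) := by
  rw [← h B (A \ B) Set.disjoint_sdiff_right, Set.union_sdiff_self, Set.union_comm]

theorem IsGroupMeasure.eq_inter_add (h : IsGroupMeasure μ) (A B : Set S) :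
    μ A = μ (A ∩ B) + μ (A \ B) := by
  rw [← h _ _ (Set.disjoint_sdiff_inter.symm), Set.inter_union_sdiff]

open Classical in
theorem IsGroupMeasure.eq_sum [Fintype S] (h : IsGroupMeasure μ) (A : Set S) :
    μ A = ∑ p, if p ∈ A then μ {p} else 0 := by
  have key : ∀ T : Finset S, μ (T : Set S) = ∑ p ∈ T, μ {p} := by
    intro T
    induction T using Finset.induction_on with
    | empty => simpa using h.empty
    | insert a T ha ih =>
      rw [Finset.sum_insert ha, ← ih, Finset.coe_insert, Set.insert_eq]
      exact h _ _ (by simpa using ha)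
  rw [← Finset.sum_filter, ← key]
  congr 1
  ext p
  simp

/-- Summation over subsets is invertible. -/
theorem exists_sum_powerset_eq {α : Type*} [DecidableEq α] (f : Finset α → G) :
    ∃ g : Finset α → G, ∀ I, ∑ K ∈ I.powerset, g K = f I := by
  -- Solve recursively for the top term K = I of each sum.
  refine ⟨Finset.strongInduction fun s ih => f s - ∑ K ∈ s.ssubsets.attach,
    ih K.1 (Finset.mem_ssubsets.1 K.2), fun I => ?_⟩
  rw [← Finset.insert_erase (Finset.mem_powerset_self I), Finset.sum_insert (by simp)]
  nth_rw 1 [Finset.strongInduction_eq]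
  rw [Finset.sum_attach I.ssubsets
    (fun K => Finset.strongInduction (fun s ih => f s - ∑ K ∈ s.ssubsets.attach,
    ih K.1 (Finset.mem_ssubsets.1 K.2)) K)]
  exact sub_add_cancel _ _

theorem mem_region {n : ℕ} {A : Finset (Fin n)} {p : Atom n} :
    p ∈ region A ↔ ¬ p.1 ⊆ Aᶜ := by
  simp only [region, Set.mem_ofPred_eq, Finset.not_subset, Finset.mem_compl, not_not]
  exact exists_congr fun i => and_comm

theorem region_union {n : ℕ} (A B : Finset (Fin n)) : region (A ∪ B) = region A ∪ region B := by
  ext p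
  simp only [region, Set.mem_ofPred_eq, Set.mem_union, Finset.mem_union, or_and_right, exists_or]

/-- Group measures on the diagram can be prescribed on the regions, up to a constant. -/
theorem exists_isGroupMeasure_region {n : ℕ} (F : Finset (Fin n) → G) :
    ∃ μ : Set (Atom n) → G, IsGroupMeasure μ ∧ ∀ A, μ (region A) = F A - F ∅ := by
  classical
  -- Atoms outside `region A` are the nonempty subsets of Aᶜ, so the region's measure is the total
  -- minus a sum over these. The empty set is no atom; dropping its term g ∅ = -F univ adds a
  -- constant that cancels in the difference.
  obtain ⟨g, hg⟩ := exists_sum_powerset_eq fun C : Finset (Fin n) => - F Cᶜ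
  have hsum : ∀ C : Finset (Fin n),
      (∑ p : Atom n, if p.1 ⊆ C then g p.1 else 0) = - F Cᶜ + F univ := by
    intro C
    have h0 : g ∅ = - F univ := by simpa using hg ∅
    have h1 := hg C
    rw [← Finset.insert_erase (Finset.empty_mem_powerset C), Finset.sum_insert (by simp), h0,
      neg_add_eq_iff_eq_add] at h1
    rw [add_comm, ← h1, ← Finset.sum_filter]
    refine Finset.sum_bij (fun p _ => p.1) ?_ ?_ ?_ ?_
    · intro p hp
      simpa [p.2.ne_empty] using hp
    · exact fun p _ q _ h => Subtype.ext h
    · intro K hK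
      simp only [Finset.mem_erase, Finset.mem_powerset] at hK
      exact ⟨⟨K, Finset.nonempty_iff_ne_empty.2 hK.1⟩, by simpa using hK.2, rfl⟩
    · exact fun _ _ => rfl
  refine ⟨fun S => ∑ p : Atom n, if p ∈ S then g p.1 else 0, fun A B hAB => ?_, fun A => ?_⟩
  · rw [← Finset.sum_add_distrib]
    refine Finset.sum_congr rfl fun p _ => ?_
    by_cases h1 : p ∈ A
    · simp [h1, Set.disjoint_left.1 hAB h1]
    · simp [h1]
  · have h1 : (∑ p : Atom n, if p ∈ region A then g p.1 else 0) =
        (∑ p : Atom n, if p.1 ⊆ univ then g p.1 else 0) -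
          ∑ p : Atom n, if p.1 ⊆ Aᶜ then g p.1 else 0 := by
      rw [← Finset.sum_sub_distrib]
      refine Finset.sum_congr rfl fun p _ => ?_
      by_cases h2 : p.1 ⊆ Aᶜ
      · simp [mem_region, h2]
      · simp [mem_region, h2]
    refine h1.trans ?_
    rw [hsum, hsum, compl_compl, Finset.compl_univ]
    abel

end GroupMeasure

/-! ### Existence, uniqueness and vanishing atoms -/

section Diagram

variable {Ω : Type u} [Fintype Ω] {n : ℕ} {X : Fin n → DiscreteRV.{u, v} Ω}
  {μ ν : Set (Atom n) → Meas (RestrictedPair X)}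

/-- For q = 1 compare additivity on `region J ∪ region (L 0)` with the chain rule; the constant `klR
X ∅` cancels. Each further variable splits a set by its region, matching the recursion of
`klInteraction`. -/
theorem isKLDiagram_of_region (hμ : IsGroupMeasure μ)
    (h : ∀ A, μ (region A) = klR X A - klR X ∅) : IsKLDiagram X μ := by
  refine ⟨hμ, fun q => ?_⟩
  induction q with
  | zero =>
    intro J L
    have e : (⋂ k, region (L k)) = region (L 0) := by
      ext p
      simp [Fin.forall_fin_one]
    have h1 := hμ.union_eq (region (L 0)) (region J)
    rw [← region_union, Finset.union_comm, h, h, klR_union] at h1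
    rw [e]
    change actR X J (klR X (L 0)) = _
    rw [add_sub_right_comm] at h1
    exact add_left_cancel h1
  | succ q ih =>
    intro J L
    rw [klInteraction, actR_sub, actR_actR, ih, ih, region_union]
    have e : (⋂ k, region (L k)) =
        (⋂ k : Fin (q + 1), region (L k.castSucc)) ∩ region (L (Fin.last (q + 1))) := by
      ext p
      simp only [Set.mem_iInter, Set.mem_inter_iff]
      exact Fin.forall_fin_succ'
    rw [hμ.eq_inter_add ((⋂ k : Fin (q + 1), region (L k.castSucc)) \ region J)
      (region (L (Fin.last (q + 1)))), Set.sdiff_sdiff, add_sub_cancel_right, e]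
    congr 1
    ext p
    simp only [Set.mem_inter_iff, Set.mem_sdiff]
    tauto

/-- For p = p_I, the circles of k ∈ I force K ⊇ I, and removing `region Iᶜ` forces K ⊆ I. Slots with
k ∉ I are filled by I itself, which excludes nothing new; `n + 1` variables supply the required
nonempty list. -/
theorem singleton_eq_region (p : Atom (n + 1)) :
    {p} = (⋂ k : Fin (n + 1), region (if k ∈ p.1 then {k} else p.1)) \ region p.1ᶜ := by
  ext r
  simp only [Set.mem_singleton_iff, Set.mem_sdiff, Set.mem_iInter, mem_region, compl_compl,
    not_not]
  constructor
  · rintro rfl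
    refine ⟨fun k => ?_, Finset.Subset.refl _⟩
    split_ifs with hk
    · exact fun h => by simpa using h hk
    · obtain ⟨i, hi⟩ := r.2
      exact fun h => Finset.mem_compl.1 (h hi) hi
  · rintro ⟨h1, h2⟩
    refine Subtype.ext (Finset.Subset.antisymm h2 fun k hk => ?_)
    by_contra hkr
    refine h1 k fun a ha => ?_
    rw [if_pos hk, Finset.mem_compl, Finset.mem_singleton]
    rintro rfl
    exact hkr ha

theorem IsKLDiagram.ext (hμ : IsKLDiagram X μ) (hν : IsKLDiagram X ν) : μ = ν := by
  classical
  funext S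
  rw [hμ.1.eq_sum, hν.1.eq_sum]
  refine Finset.sum_congr rfl fun p _ => ?_
  cases n with
  | zero => exact p.2.elim fun i _ => i.elim0
  | succ n => rw [singleton_eq_region p, ← hμ.2, ← hν.2]

/-- An atom whose circles include that of a variable, but not that of its predecessor,
vanishes. -/
theorem IsKLDiagram.atom_eq_zero (hμ : IsKLDiagram X μ) {i j : Fin n} (hij : (j : ℕ) = i + 1)
    (I : Finset (Fin n)) (hI : I.Nonempty) (hj : j ∈ I) (hi : i ∉ I) : μ {⟨I, hI⟩} = 0 := by
  classical
  induction I using Finset.strongInduction with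
  | H I ih =>
    -- The set on the right consists of the atoms p_K with j ∈ K ⊆ I. Those with K ≠ I also omit i,
    -- so they vanish by induction.
    have h1 := hμ.2 0 Iᶜ fun _ => {j}
    have h2 := klR_union (X := X) Iᶜ {j}
    rw [Finset.union_comm, ← Finset.insert_eq, klR_insert hij (by simpa using hi),
      left_eq_add] at h2
    change actR X Iᶜ (klR X {j}) = _ at h1
    rw [h2, Set.iInter_const, hμ.1.eq_sum, Finset.sum_eq_single ⟨I, hI⟩, if_pos] at h1
    · exact h1.symm
    · simp [mem_region, hj]
    · intro p _ hp
      split_ifs with hpS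
      · simp only [Set.mem_sdiff, mem_region, compl_compl, not_not, Finset.subset_compl_singleton]
          at hpS
        exact ih p.1 (lt_of_le_of_ne hpS.2 fun h => hp (Subtype.ext h)) p.2 (by simpa using hpS.1)
          fun h => hi (hpS.2 h)
      · rfl
    · simp

/-- Closure under predecessors makes I downward closed, so the interval found starts at 0. -/
theorem exists_eq_Icc {I : Finset (Fin n)} (hI : I.Nonempty)
    (h : ∀ i j : Fin n, (j : ℕ) = i + 1 → j ∈ I → i ∈ I) : ∃ i k : Fin n, I = Finset.Icc i k := by
  have hn : 0 < n := lt_of_le_of_lt (Nat.zero_le _) (I.max' hI).2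
  refine ⟨⟨0, hn⟩, I.max' hI, ?_⟩
  have key : ∀ (d : ℕ) (a b : Fin n), (b : ℕ) = a + d → b ∈ I → a ∈ I := by
    intro d
    induction d with
    | zero => exact fun a b hab hb => (Fin.ext hab : b = a) ▸ hb
    | succ d ih =>
      intro a b hab hb
      have hd : (a : ℕ) + d < n := by have := b.2; omega
      exact ih a ⟨a + d, hd⟩ rfl (h _ b (by simp only; omega) hb)
  ext a
  rw [Finset.mem_Icc]
  constructor
  · exact fun ha => ⟨Fin.mk_le_of_le_val (Nat.zero_le _), I.le_max' a ha⟩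
  · rintro ⟨_, ha⟩
    exact key (I.max' hI - a) a _ (by rw [Fin.le_def] at ha; omega) (I.max'_mem hI)

end Diagram

end KLDiagram

theorem mainTheorem8 {Ω : Type u} [Fintype Ω] {n : ℕ} (X : Fin n → KLDiagram.DiscreteRV.{u, v} Ω) :
    (∃! μ : Set (KLDiagram.Atom n) → KLDiagram.Meas (KLDiagram.RestrictedPair X),
      KLDiagram.IsKLDiagram X μ) ∧
    ∀ μ : Set (KLDiagram.Atom n) → KLDiagram.Meas (KLDiagram.RestrictedPair X),
      KLDiagram.IsKLDiagram X μ →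
        (∀ (I : Finset (Fin n)) (hI : I.Nonempty),
          (¬ ∃ i k : Fin n, I = Finset.Icc i k) → μ {⟨I, hI⟩} = 0) ∧
        (∀ (i k : Fin n) (hik : i ≤ k), 1 ≤ (i : ℕ) →
          μ {⟨Finset.Icc i k, Finset.nonempty_Icc.2 hik⟩} = 0) := by
  refine ⟨?_, fun μ hμ => ⟨fun I hI hint => ?_, fun i k hik hi => ?_⟩⟩
  · obtain ⟨μ, hμ, hF⟩ := KLDiagram.exists_isGroupMeasure_region (KLDiagram.klR X)
    have h := KLDiagram.isKLDiagram_of_region hμ hF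
    exact ⟨μ, h, fun ν hν => hν.ext h⟩
  · have h : ∃ i j : Fin n, (j : ℕ) = i + 1 ∧ j ∈ I ∧ i ∉ I := by
      by_contra hne
      push Not at hne
      exact hint (KLDiagram.exists_eq_Icc hI hne)
    obtain ⟨i, j, hij, hj, hi⟩ := h
    exact hμ.atom_eq_zero hij I hI hj hi
  -- Indices start at 0, so `1 ≤ i` says that the left end has a predecessor, which lies outside the
  -- interval.
  · have hlt : (i : ℕ) - 1 < n := by omega
    refine hμ.atom_eq_zero (i := ⟨i - 1, hlt⟩) (j := i) (by simp only; omega) _ _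
      (Finset.left_mem_Icc.2 hik) fun h => ?_
    have := (Finset.mem_Icc.1 h).1
    rw [Fin.le_def] at this
    simp only at this
    omega
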